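/- **Setting.** Let $\Sigma$ be a finite alphabet. A hidden Markov model $\mathcal M=(k,M,\Pi_0,P^{(1)},\dots,P^{(k)})$ consists of a row-stochastic $k\times k$ matrix $M$, an initial distribution $\Pi_0$ on $[k]$ and distributions $P^{(1)},\dots,P^{(k)}$ on $\Sigma$; it generates states $Z_0\sim\Pi_0$, $\Pr[Z_{t+1}=j\mid Z_t=i]=M_{ij}$, and outputs $X_t\sim P^{(Z_t)}$ (independently given the states). The chain is assumed irreducible and aperiodic; $\Pi$ denotes its stationary distribution. All entropies are in bits, and $H(\mathcal M)=\lim_{t\to\infty}\frac1t H(X_0,\dots,X_{t-1})$ is the entropy rate. For $L\ge 1$ and $\gamma\in\Sigma^L$ let $P_L(\gamma)=\Pr[(X_0,\dots,X_{L-1})=\gamma]$ when $Z_0\sim\Pi$. * $L$ is *$\epsilon$-compressive* if $H(X_0,\dots,X_{L-1})+1\le H(\mathcal M)(1+\epsilon)L$, where the entropy is taken for $Z_0\sim\Pi$. * $L$ is *$\epsilon$-mixing* if $\sum_b|\rho_{ab,L}-\Pi(a)\Pi(b)|\le\epsilon\,\Pi(a)$ for every state $a$, where $\rho_{ab,L}=\Pr[Z_0=a,\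 Z_L=b]=\Pi(a)(M^L)_{ab}$ for $Z_0\sim\Pi$. * For $\epsilon,\delta>0$, an algorithm $A:\Sigma^*\to\{0,1\}^*$ is an *$(\epsilon,\delta)$-good compressor* for $\mathcal M$ if there is $n_0$ such that for all $n\ge n_0$ $$\Pr\big[\,|A(X_0,\dots,X_{n-1})|\le H(\mathcal M)(1+\epsilon)n\,\big]\ \ge\ 1-\delta .$$ * Let $\mathrm{Huff}:\Sigma^L\to\{0,1\}^*$ be any prefix-free code with $|\mathrm{Huff}(\gamma)|\le 1+\log_2(1/P_L(\gamma))$ for every $\gamma$ (no restriction when $P_L(\gamma)=0$), for example a Shannon code. The *Iterated Huffman* compressor $\mathrm{IH}_{L,\mathcal M}$ cuts its input into successive blocks of length $L$ and outputs the concatenation of the codewords $\mathrm{Huff}(Y_0)\,\mathrm{Huff}(Y_1)\cdots$ of these blocks; if $L$ does not divide the length of the input, the remaining fewer than $L$ letters are encoded by an arbitrary fixed map $\Sigma^{*}\to\{0,1\}^*$, whose output is appended. **Lemma.** For every hidden Markov model $\mathcal M$ with irreducible aperiodic chain and every $\epsilon>0$ there exist $\epsilon_1>0$ and $\epsilon_2>0$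 such that, whenever $L$ is $\epsilon_1$-compressive and $\epsilon_2$-mixing (and for every admissible choice of $\mathrm{Huff}$ and of the map used for the incomplete last block), for every $\delta>0$ the compressor $\mathrm{IH}_{L,\mathcal M}$ is an $(\epsilon,\delta)$-good compressor for $\mathcal M$. Moreover the required length depends only logarithmically on $1/\delta$: there is a constant $C$, independent of $\delta$, such that for every $0<\delta\le 1$ every $n\ge C(1+\log(1/\delta))$ satisfies $$\Pr\big[\,|\mathrm{IH}_{L,\mathcal M}(X_0,\dots,X_{n-1})|\le H(\mathcal M)(1+\epsilon)n\,\big]\ \ge\ 1-\delta .$$ -/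

import Mathlib

open Filter Topology
open scoped BigOperators Matrix

noncomputable section

/-- A hidden Markov model with state space `Fin k` and finite output alphabet `A`: a row-stochastic
transition matrix, an initial state distribution, and an output distribution for each state. -/
structure HMM (k : ℕ) (A : Type*) [Fintype A] where
  trans : Matrix (Fin k) (Fin k) ℝ
  init : Fin k → ℝ
  emit : Fin k → A → ℝ
  trans_mem : trans ∈ Matrix.rowStochastic ℝ (Fin k)
  init_mem : init ∈ stdSimplex ℝ (Fin k)
  emit_mem : ∀ a, emit a ∈ stdSimplex ℝ A

namespace HMM

variable {k : ℕ} {A : Type*} [Fintype A]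

/-- The chain is irreducible: every state can be reached from every state. -/
def Irreducible (M : HMM k A) : Prop :=
  ∀ i j : Fin k, ∃ t : ℕ, 0 < (M.trans ^ t) i j

/-- `ℓ` is a cycle length of the chain: for some state, the probability of being back in it after
`ℓ` steps is positive. -/
def IsCycleLength (M : HMM k A) (ℓ : ℕ) : Prop :=
  0 < ℓ ∧ ∃ i : Fin k, 0 < (M.trans ^ ℓ) i i

/-- The chain is aperiodic: the greatest common divisor of all cycle lengths is `1`. -/
def Aperiodic (M : HMM k A) : Prop :=
  ∀ d : ℕ, (∀ ℓ, M.IsCycleLength ℓ → d ∣ ℓ) → d = 1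

/-- `π` is a probability distribution on the states with `π = π M`. -/
def IsStationary (M : HMM k A) (π : Fin k → ℝ) : Prop :=
  π ∈ stdSimplex ℝ (Fin k) ∧ π ᵥ* M.trans = π

/-- Every finite chain has a stationary distribution: normalise the absolute value of a left
eigenvector for the eigenvalue `1`. -/
theorem exists_isStationary (M : HMM k A) : ∃ π : Fin k → ℝ, M.IsStationary π := by
  classical
  obtain ⟨hnn, hrow⟩ := Matrix.mem_rowStochastic_iff_sum.1 M.trans_mem
  have hk : Nonempty (Fin k) := by
    by_contra h
    rw [not_nonempty_iff] at h
    have := M.init_mem.2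
    simp at this
  have hdet : (M.trans - 1).det = 0 := by
    rw [← Matrix.exists_mulVec_eq_zero_iff]
    refine ⟨1, one_ne_zero, ?_⟩
    rw [Matrix.sub_mulVec, (Matrix.mem_rowStochastic.1 M.trans_mem).2, Matrix.one_mulVec, sub_self]
  obtain ⟨v, hv0, hv⟩ := Matrix.exists_vecMul_eq_zero_iff.2 hdet
  rw [Matrix.vecMul_sub, Matrix.vecMul_one, sub_eq_zero] at hv
  have hv' : ∀ j, ∑ i, v i * M.trans i j = v j := fun j => by
    simpa [Matrix.vecMul, dotProduct] using congrFun hv j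
  have hle : ∀ j ∈ Finset.univ, |v j| ≤ ∑ i, |v i| * M.trans i j := fun j _ => by
    rw [← hv' j]
    refine (Finset.abs_sum_le_sum_abs _ _).trans (le_of_eq ?_)
    refine Finset.sum_congr rfl fun i _ => ?_
    rw [abs_mul, abs_of_nonneg (hnn i j)]
  have hsum : ∑ j, |v j| = ∑ j, ∑ i, |v i| * M.trans i j := by
    rw [Finset.sum_comm]
    refine Finset.sum_congr rfl fun i _ => ?_
    rw [← Finset.mul_sum, hrow i, mul_one]
  have heq := (Finset.sum_eq_sum_iff_of_le hle).1 hsum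
  have hpos : 0 < ∑ j, |v j| := by
    obtain ⟨j, hj⟩ := Function.ne_iff.1 hv0
    exact Finset.sum_pos' (fun _ _ => abs_nonneg _) ⟨j, Finset.mem_univ _, abs_pos.2 hj⟩
  refine ⟨fun j => |v j| / ∑ i, |v i|, ⟨fun j => by positivity, ?_⟩, ?_⟩
  · rw [← Finset.sum_div, div_self hpos.ne']
  · funext j
    simp only [Matrix.vecMul, dotProduct]
    rw [heq j (Finset.mem_univ j), Finset.sum_div]
    exact Finset.sum_congr rfl fun i _ => by ring

/-- The stationary distribution `Π` of the chain (it is unique when the chain is irreducible). -/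
def stationary (M : HMM k A) : Fin k → ℝ :=
  Classical.choose M.exists_isStationary

/-- The probability that `(Z_0, …, Z_n) = z` and `(X_0, …, X_{n-1}) = x` when `Z_0` has
distribution `ν`. -/
def pathProb (M : HMM k A) (ν : Fin k → ℝ) {n : ℕ} (z : Fin (n + 1) → Fin k) (x : Fin n → A) : ℝ :=
  ν (z 0) * ∏ t : Fin n, (M.emit (z t.castSucc) (x t) * M.trans (z t.castSucc) (z t.succ))

/-- The probability that `(X_0, …, X_{n-1}) = x` when `Z_0` has distribution `ν`. -/
def wordProb (M : HMM k A) (ν : Fin k → ℝ) {n : ℕ} (x : Fin n → A) : ℝ :=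
  ∑ z : Fin (n + 1) → Fin k, M.pathProb ν z x

open Classical in
/-- The probability of the event `(X_0, …, X_{n-1}) ∈ E` when the model is started from its own
initial distribution. -/
def prob (M : HMM k A) {n : ℕ} (E : Set (Fin n → A)) : ℝ :=
  ∑ x : Fin n → A, if x ∈ E then M.wordProb M.init x else 0

/-- The Shannon entropy `H(X_0, …, X_{n-1})`, in bits, when `Z_0` has distribution `ν`. -/
def blockEntropy (M : HMM k A) (ν : Fin k → ℝ) (n : ℕ) : ℝ :=
  ∑ x : Fin n → A, M.wordProb ν x * Real.logb 2 (1 / M.wordProb ν x)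

/-- The entropy rate `H(M) = lim_{t → ∞} H(X_0, …, X_{t-1}) / t` of the model. -/
def entropyRate (M : HMM k A) : ℝ :=
  limUnder atTop fun t : ℕ => M.blockEntropy M.init t / t

/-- `P_L(γ)`: the probability that `(X_0, …, X_{L-1}) = γ` when `Z_0` is stationary. -/
def blockProb (M : HMM k A) {L : ℕ} (γ : Fin L → A) : ℝ :=
  M.wordProb M.stationary γ

/-- `L` is `ε`-compressive: `H(X_0, …, X_{L-1}) + 1 ≤ H(M) (1 + ε) L`, where the entropy is that of
the stationary process. -/
def IsCompressive (M : HMM k A) (ε : ℝ) (L : ℕ) : Prop :=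
  M.blockEntropy M.stationary L + 1 ≤ M.entropyRate * (1 + ε) * L

/-- `ρ_{ab,L}`: the probability that `Z_0 = a` and `Z_L = b` when `Z_0` is stationary. -/
def pairProb (M : HMM k A) (L : ℕ) (a b : Fin k) : ℝ :=
  M.stationary a * (M.trans ^ L) a b

/-- `L` is `ε`-mixing: `∑_b |ρ_{ab,L} - Π(a) Π(b)| ≤ ε Π(a)` for every state `a`. -/
def IsMixing (M : HMM k A) (ε : ℝ) (L : ℕ) : Prop :=
  ∀ a : Fin k, ∑ b, |M.pairProb L a b - M.stationary a * M.stationary b| ≤ ε * M.stationary a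

/-- The event that `alg` compresses `(X_0, …, X_{n-1})` to at most `H(M) (1 + ε) n` bits. -/
def shortEvent (M : HMM k A) (ε : ℝ) (alg : List A → List Bool) (n : ℕ) : Set (Fin n → A) :=
  {x | ((alg (List.ofFn x)).length : ℝ) ≤ M.entropyRate * (1 + ε) * n}

/-- `alg` is an `(ε, δ)`-good compressor for the model. -/
def IsGoodCompressor (M : HMM k A) (ε δ : ℝ) (alg : List A → List Bool) : Prop :=
  ∃ n₀ : ℕ, ∀ n : ℕ, n₀ ≤ n → 1 - δ ≤ M.prob (M.shortEvent ε alg n)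

/-- The block codes used by the Iterated Huffman algorithm: prefix-free binary codes
`Huff : A^L → {0,1}^*` with `|Huff(γ)| ≤ 1 + log₂ (1 / P_L(γ))` for every `γ`. (The right-hand side
is `+∞`, so that the bound is no restriction, if `P_L(γ) = 0`.) -/
structure IsBlockCode (M : HMM k A) {L : ℕ} (huff : (Fin L → A) → List Bool) : Prop where
  prefix_free : ∀ γ γ' : Fin L → A, huff γ <+: huff γ' → γ = γ'
  length_le : ∀ γ : Fin L → A, 0 < M.blockProb γ →
    ((huff γ).length : ℝ) ≤ 1 + Real.logb 2 (1 / M.blockProb γ)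

end HMM

/-- The `j`-th block of length `L` of the word `w`. -/
def wordBlock {A : Type*} {L : ℕ} (w : List A) (j : Fin (w.length / L)) : Fin L → A := fun i =>
  w.get ⟨j * L + i, calc
    (j : ℕ) * L + i < j * L + L := Nat.add_lt_add_left i.2 _
    _ = (j + 1) * L := (Nat.succ_mul _ _).symm
    _ ≤ w.length / L * L := Nat.mul_le_mul_right L j.2
    _ ≤ w.length := Nat.div_mul_le_self _ _⟩

/-- The Iterated Huffman compressor with block length `L` and block code `huff`: the concatenation
of the codewords of the successive blocks of length `L`. If `L` does not divide the length of the
word, the incomplete last block is encoded by `tail`. -/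
def iteratedHuffman {A : Type*} {L : ℕ} (huff : (Fin L → A) → List Bool)
    (tail : List A → List Bool) (w : List A) : List Bool :=
  (List.ofFn fun j : Fin (w.length / L) => huff (wordBlock w j)).flatten ++
    if L ∣ w.length then [] else tail (w.drop (w.length / L * L))

end

/-!
The length of the Iterated Huffman output is controlled by an exponential moment of the hidden
Markov chain observed at block boundaries, where its transition matrix is `K = M^L`.

Let `f a` (`HMM.meanLength`) be the expected codeword length of a block that starts in state `a`.
The code-length bound gives `∑ a, Π a * f a ≤ H(X_0, …, X_{L-1}) + 1`
(`HMM.sum_stationary_mul_meanLength_le`), and compressivity bounds this by `H(M) (1 + ε₁) L`. As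
the chain is irreducible, `Π` is bounded below, so a small enough mixing parameter forces
`K a b ≤ (1 + η) Π b` for all states, and `K f ≤ (1 + η) ∑ a, Π a * f a < c` with
`c = H(M) (1 + ε / 2) L`.

Consecutive blocks are dependent: the output of a block is correlated with the state in which it
ends. This is handled by using `f` as a potential. The increment `|huff γ| - c + f b - f a` of a
block `γ` from `a` to `b` has conditional mean `K f a - c < 0`, and it takes finitely many values,
so for some `r > 0` its exponential moment of order `r` is at most one from every starting state
(`HMM.exists_pos_forall_sum_exp_drift_le_one`). Induction on the number of blocks bounds the
exponential moment of the total code length by `exp (r (c N + f a))` for `N` blocks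
(`HMM.sum_exp_blocksLength_le`), whatever the initial distribution is. Markov's inequality
(`HMM.one_sub_exp_le_prob_shortEvent`) then bounds the failure probability by
`exp (O(1) - r H(M) (ε / 2) n)`, which is at most `δ` once `n` is at least a constant times
`1 + log (1 / δ)`.

Only the value of `H(M)` as a real number enters: compressivity forces it, and `L`, to be positive.
-/

namespace HMM

variable {k : ℕ} {A : Type*} [Fintype A]

/-! ### Words as products of matrices -/

/-- The matrix with entries `Pr[X_t = a, Z_{t+1} = j | Z_t = i]`. -/
def stepMatrix (M : HMM k A) (a : A) : Matrix (Fin k) (Fin k) ℝ :=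
  Matrix.of fun i j => M.emit i a * M.trans i j

/-- The matrix with entries `Pr[(X_0, …, X_{n-1}) = w, Z_n = j | Z_0 = i]`, where `n` is the length
of `w`. -/
def wordMatrix (M : HMM k A) (w : List A) : Matrix (Fin k) (Fin k) ℝ :=
  (w.map M.stepMatrix).prod

theorem trans_nonneg (M : HMM k A) (i j : Fin k) : 0 ≤ M.trans i j :=
  (Matrix.mem_rowStochastic_iff_sum.1 M.trans_mem).1 i j

theorem stepMatrix_nonneg (M : HMM k A) (a : A) (i j : Fin k) : 0 ≤ M.stepMatrix a i j :=
  mul_nonneg ((M.emit_mem i).1 a) (M.trans_nonneg i j)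

theorem sum_stepMatrix (M : HMM k A) : ∑ a, M.stepMatrix a = M.trans := by
  ext i j
  rw [Matrix.sum_apply]
  simp only [stepMatrix, Matrix.of_apply]
  rw [← Finset.sum_mul, (M.emit_mem i).2, one_mul]

@[simp] theorem wordMatrix_nil (M : HMM k A) : M.wordMatrix [] = 1 := rfl

@[simp] theorem wordMatrix_cons (M : HMM k A) (a : A) (w : List A) :
    M.wordMatrix (a :: w) = M.stepMatrix a * M.wordMatrix w := by
  simp [wordMatrix]

theorem wordMatrix_append (M : HMM k A) (v w : List A) :
    M.wordMatrix (v ++ w) = M.wordMatrix v * M.wordMatrix w := by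
  simp [wordMatrix]

theorem wordMatrix_nonneg (M : HMM k A) (w : List A) (i j : Fin k) : 0 ≤ M.wordMatrix w i j := by
  induction w generalizing i j with
  | nil =>
    rw [wordMatrix_nil, Matrix.one_apply]
    split_ifs <;> norm_num
  | cons a w ih =>
    rw [wordMatrix_cons, Matrix.mul_apply]
    exact Finset.sum_nonneg fun l _ => mul_nonneg (M.stepMatrix_nonneg a i l) (ih l j)

theorem sum_wordMatrix (M : HMM k A) (n : ℕ) :
    ∑ x : Fin n → A, M.wordMatrix (List.ofFn x) = M.trans ^ n := by
  induction n with
  | zero => simp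
  | succ n ih =>
    rw [← (Fin.consEquiv fun _ : Fin (n + 1) => A).sum_comp, Fintype.sum_prod_type]
    simp only [Fin.consEquiv_apply, List.ofFn_succ, Fin.cons_zero, Fin.cons_succ, wordMatrix_cons]
    simp_rw [← Finset.mul_sum, ih, ← Finset.sum_mul, sum_stepMatrix, pow_succ']

theorem wordProb_cons (M : HMM k A) (ν : Fin k → ℝ) {n : ℕ} (a : A) (x : Fin n → A) :
    M.wordProb ν (Fin.cons a x : Fin (n + 1) → A) = M.wordProb (ν ᵥ* M.stepMatrix a) x := by
  unfold wordProb
  rw [← (Fin.consEquiv fun _ : Fin (n + 2) => Fin k).sum_comp, Fintype.sum_prod_type,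
    Finset.sum_comm]
  refine Finset.sum_congr rfl fun z _ => ?_
  simp only [pathProb, Fin.consEquiv_apply, Matrix.vecMul, dotProduct, Finset.sum_mul]
  refine Finset.sum_congr rfl fun i _ => ?_
  rw [Fin.prod_univ_succ]
  simp only [Fin.castSucc_zero, Fin.cons_zero, Fin.cons_succ, ← Fin.succ_castSucc, stepMatrix,
    Matrix.of_apply]
  ring

theorem wordProb_eq (M : HMM k A) (ν : Fin k → ℝ) {n : ℕ} (x : Fin n → A) :
    M.wordProb ν x = ∑ i, ν i * ∑ j, M.wordMatrix (List.ofFn x) i j := by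
  have key : M.wordProb ν x = ∑ j, (ν ᵥ* M.wordMatrix (List.ofFn x)) j := by
    induction n generalizing ν with
    | zero =>
      rw [List.ofFn_zero, wordMatrix_nil, Matrix.vecMul_one]
      simp only [wordProb, pathProb, Finset.univ_eq_empty, Finset.prod_empty, mul_one]
      exact (Equiv.funUnique (Fin 1) (Fin k)).sum_comp ν
    | succ n ih =>
      rw [← Fin.cons_self_tail x, wordProb_cons, ih, Matrix.vecMul_vecMul]
      simp only [List.ofFn_succ, Fin.cons_zero, Fin.cons_succ, wordMatrix_cons]
  rw [key]
  simp only [Matrix.vecMul, dotProduct]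
  rw [Finset.sum_comm]
  simp only [Finset.mul_sum]

theorem wordProb_nonneg (M : HMM k A) {ν : Fin k → ℝ} (hν : ∀ i, 0 ≤ ν i) {n : ℕ}
    (x : Fin n → A) : 0 ≤ M.wordProb ν x := by
  rw [wordProb_eq]
  exact Finset.sum_nonneg fun i _ =>
    mul_nonneg (hν i) (Finset.sum_nonneg fun j _ => M.wordMatrix_nonneg _ i j)

theorem sum_trans_pow (M : HMM k A) (n : ℕ) (i : Fin k) : ∑ j, (M.trans ^ n) i j = 1 :=
  (Matrix.mem_rowStochastic_iff_sum.1 (pow_mem M.trans_mem n)).2 i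

theorem trans_pow_nonneg (M : HMM k A) (n : ℕ) (i j : Fin k) : 0 ≤ (M.trans ^ n) i j :=
  (Matrix.mem_rowStochastic_iff_sum.1 (pow_mem M.trans_mem n)).1 i j

theorem sum_wordMatrix_apply (M : HMM k A) (n : ℕ) (i j : Fin k) :
    ∑ x : Fin n → A, M.wordMatrix (List.ofFn x) i j = (M.trans ^ n) i j := by
  rw [← sum_wordMatrix, Matrix.sum_apply]

theorem sum_sum_wordMatrix (M : HMM k A) (n : ℕ) (i : Fin k) :
    ∑ x : Fin n → A, ∑ j, M.wordMatrix (List.ofFn x) i j = 1 := by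
  rw [Finset.sum_comm]
  simp_rw [sum_wordMatrix_apply, sum_trans_pow]

theorem sum_wordProb (M : HMM k A) {ν : Fin k → ℝ} (hν : ∑ i, ν i = 1) (n : ℕ) :
    ∑ x : Fin n → A, M.wordProb ν x = 1 := by
  simp_rw [wordProb_eq]
  rw [Finset.sum_comm]
  simp_rw [← Finset.mul_sum, sum_sum_wordMatrix, mul_one, hν]

/-! ### The stationary distribution -/

theorem stationary_spec (M : HMM k A) : M.IsStationary M.stationary :=
  Classical.choose_spec M.exists_isStationary

theorem stationary_vecMul_pow (M : HMM k A) (n : ℕ) :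
    M.stationary ᵥ* M.trans ^ n = M.stationary := by
  induction n with
  | zero => simp
  | succ n ih => rw [pow_succ, ← Matrix.vecMul_vecMul, ih, M.stationary_spec.2]

theorem stationary_pos (M : HMM k A) (hirr : M.Irreducible) (j : Fin k) : 0 < M.stationary j := by
  obtain ⟨hnn, hsum⟩ := M.stationary_spec.1
  obtain ⟨i, -, hi⟩ : ∃ i ∈ Finset.univ, 0 < M.stationary i := by
    by_contra! h
    linarith [Finset.sum_nonpos h]
  obtain ⟨t, ht⟩ := hirr i j
  calc 0 < M.stationary i * (M.trans ^ t) i j := mul_pos hi ht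
    _ ≤ ∑ l, M.stationary l * (M.trans ^ t) l j :=
      Finset.single_le_sum (f := fun l => M.stationary l * (M.trans ^ t) l j)
        (fun l _ => mul_nonneg (hnn l) (M.trans_pow_nonneg t l j)) (Finset.mem_univ i)
    _ = M.stationary j := congrFun (M.stationary_vecMul_pow t) j

theorem trans_pow_le_of_isMixing (M : HMM k A) {m η : ℝ} (hη : 0 ≤ η)
    (hpos : ∀ i, 0 < M.stationary i) (hm : ∀ i, m ≤ M.stationary i) {L : ℕ}
    (hmix : M.IsMixing (η * m) L) (a b : Fin k) :
    (M.trans ^ L) a b ≤ (1 + η) * M.stationary b := by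
  have h1 := (Finset.single_le_sum
    (f := fun b => |M.pairProb L a b - M.stationary a * M.stationary b|)
    (fun _ _ => abs_nonneg _) (Finset.mem_univ b)).trans (hmix a)
  have h2 := (le_abs_self _).trans h1
  simp only [pairProb] at h2
  have h3 : M.stationary a * (M.trans ^ L) a b
      ≤ M.stationary a * (M.stationary b + η * m) := by linarith
  have h4 := le_of_mul_le_mul_left h3 (hpos a)
  nlinarith [mul_le_mul_of_nonneg_left (hm b) hη]

end HMM

/-! ### Code lengths -/

section Code

variable {A : Type*} {L : ℕ}

/-- The number of bits that Iterated Huffman spends on the complete blocks of `w`. -/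
def blocksLength (huff : (Fin L → A) → List Bool) (w : List A) : ℕ :=
  (List.ofFn fun j : Fin (w.length / L) => huff (wordBlock w j)).flatten.length

theorem blocksLength_eq_zero (huff : (Fin L → A) → List Bool) {w : List A} (h : w.length < L) :
    blocksLength huff w = 0 := by
  have h0 : w.length / L = 0 := Nat.div_eq_of_lt h
  unfold blocksLength
  rw [List.ofFn_congr h0]
  simp

theorem blocksLength_append (huff : (Fin L → A) → List Bool) (hL : 0 < L) (γ : Fin L → A)
    (w : List A) :
    blocksLength huff (List.ofFn γ ++ w) = (huff γ).length + blocksLength huff w := by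
  have h : (List.ofFn γ ++ w).length / L = w.length / L + 1 := by
    rw [List.length_append, List.length_ofFn, Nat.add_div_left _ hL]
  unfold blocksLength
  rw [List.ofFn_congr h, List.ofFn_succ, List.flatten_cons, List.length_append]
  congr 3
  · ext i
    simp [wordBlock]
  · congr 1
    funext j
    congr 1
    ext i
    have h1 : ¬ ((j : ℕ) + 1) * L + i < L := by
      rw [Nat.succ_mul]; omega
    have h2 : ((j : ℕ) + 1) * L + i - L = j * L + i := by
      rw [Nat.succ_mul]; omega
    simp [wordBlock, List.getElem_append, h1, h2]

theorem sum_ofFn_append [Fintype A] {R : Type*} [AddCommMonoid R] (m n : ℕ) (g : List A → R) :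
    ∑ x : Fin (m + n) → A, g (List.ofFn x)
      = ∑ y : Fin m → A, ∑ z : Fin n → A, g (List.ofFn y ++ List.ofFn z) := by
  rw [← (Fin.appendEquiv m n).sum_comp, Fintype.sum_prod_type]
  simp [Fin.appendEquiv, List.ofFn_fin_append]

/-- The fixed map used for the incomplete last block costs a bounded number of bits. -/
theorem exists_length_iteratedHuffman_le [Fintype A] (huff : (Fin L → A) → List Bool)
    (tail : List A → List Bool) (hL : 0 < L) :
    ∃ T : ℕ, ∀ w : List A, (iteratedHuffman huff tail w).length ≤ blocksLength huff w + T := by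
  have hfin : {v : List A | v.length < L}.Finite := List.finite_length_lt A L
  obtain ⟨T, hT⟩ := (hfin.image fun v => (tail v).length).bddAbove
  refine ⟨T, fun w => ?_⟩
  unfold iteratedHuffman
  rw [List.length_append]
  refine Nat.add_le_add_left ?_ _
  split_ifs with h
  · simp
  · refine hT ⟨_, ?_, rfl⟩
    have := Nat.mod_lt w.length hL
    have h2 := Nat.div_add_mod' w.length L
    simp only [Set.mem_ofPred_eq, List.length_drop]
    omega

end Code

/-! ### The exponential moment bound -/

/-- A bounded family with negative drift under nonnegative weights of total mass one has a small
exponential moment of size at most one. -/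
theorem exists_pos_forall_sum_mul_exp_le_one {ι κ : Type*} [Fintype ι] [Fintype κ]
    (p D : κ → ι → ℝ) (hp : ∀ a i, 0 ≤ p a i) (hsum : ∀ a, ∑ i, p a i = 1) {Δ : ℝ} (hΔ : 0 < Δ)
    (hD : ∀ a, ∑ i, p a i * D a i ≤ -Δ) :
    ∃ r > (0 : ℝ), ∀ a, ∑ i, p a i * Real.exp (r * D a i) ≤ 1 := by
  obtain ⟨B, hB⟩ := (Set.finite_range fun q : κ × ι => |D q.1 q.2|).bddAbove
  obtain ⟨c, hc, hbc⟩ : ∃ c : ℝ, 0 < c ∧ ∀ a i, |D a i| ≤ c :=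
    ⟨|B| + 1, by positivity, fun a i => (hB ⟨(a, i), rfl⟩).trans (by linarith [le_abs_self B])⟩
  -- `r c ≤ 1` makes the quadratic bound on `exp` available, and `r c² ≤ Δ` absorbs its error.
  have hr : 0 < min (1 / c) (Δ / c ^ 2) := lt_min (by positivity) (by positivity)
  refine ⟨min (1 / c) (Δ / c ^ 2), hr, fun a => ?_⟩
  have h1 : min (1 / c) (Δ / c ^ 2) * c ≤ 1 := by
    rw [← le_div_iff₀ hc]; exact min_le_left _ _
  have h2 : min (1 / c) (Δ / c ^ 2) * c ^ 2 ≤ Δ := by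
    rw [← le_div_iff₀ (by positivity)]; exact min_le_right _ _
  generalize min (1 / c) (Δ / c ^ 2) = r at hr h1 h2
  have hexp : ∀ i, Real.exp (r * D a i) ≤ 1 + r * D a i + r ^ 2 * c ^ 2 := fun i => by
    have habs : |r * D a i| ≤ r * c := by
      rw [abs_mul, abs_of_pos hr]
      exact mul_le_mul_of_nonneg_left (hbc a i) hr.le
    have h3 := (abs_le.1 (Real.abs_exp_sub_one_sub_id_le (habs.trans h1))).2
    have h4 : (r * D a i) ^ 2 ≤ (r * c) ^ 2 := sq_le_sq' (neg_le_of_abs_le habs) (le_of_abs_le habs)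
    nlinarith
  calc ∑ i, p a i * Real.exp (r * D a i)
      ≤ ∑ i, p a i * (1 + r * D a i + r ^ 2 * c ^ 2) :=
        Finset.sum_le_sum fun i _ => mul_le_mul_of_nonneg_left (hexp i) (hp a i)
    _ = (1 + r ^ 2 * c ^ 2) * ∑ i, p a i + r * ∑ i, p a i * D a i := by
        rw [Finset.mul_sum, Finset.mul_sum, ← Finset.sum_add_distrib]
        exact Finset.sum_congr rfl fun i _ => by ring
    _ ≤ 1 := by
        rw [hsum]
        nlinarith [mul_le_mul_of_nonneg_left (hD a) hr.le, mul_le_mul_of_nonneg_left h2 hr.le]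

namespace HMM

variable {k : ℕ} {A : Type*} [Fintype A] {L : ℕ}

/-- The expected length of the codeword of `(X_0, …, X_{L-1})` when `Z_0 = a`. -/
def meanLength (M : HMM k A) (huff : (Fin L → A) → List Bool) (a : Fin k) : ℝ :=
  ∑ γ : Fin L → A, ((huff γ).length : ℝ) * ∑ b, M.wordMatrix (List.ofFn γ) a b

theorem meanLength_nonneg (M : HMM k A) (huff : (Fin L → A) → List Bool) (a : Fin k) :
    0 ≤ M.meanLength huff a :=
  Finset.sum_nonneg fun _ _ => mul_nonneg (Nat.cast_nonneg _)
    (Finset.sum_nonneg fun b _ => M.wordMatrix_nonneg _ a b)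

theorem sum_stationary_mul_meanLength_le (M : HMM k A) {huff : (Fin L → A) → List Bool}
    (hcode : M.IsBlockCode huff) :
    ∑ a, M.stationary a * M.meanLength huff a ≤ M.blockEntropy M.stationary L + 1 := by
  have hst := M.stationary_spec.1
  have h1 : ∑ a, M.stationary a * M.meanLength huff a
      = ∑ γ : Fin L → A, M.blockProb γ * (huff γ).length := by
    simp only [meanLength, blockProb, wordProb_eq, Finset.mul_sum, Finset.sum_mul]
    rw [Finset.sum_comm]
    refine Finset.sum_congr rfl fun γ _ => Finset.sum_congr rfl fun a _ =>
      Finset.sum_congr rfl fun b _ => by ring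
  have h2 : M.blockEntropy M.stationary L + 1
      = ∑ γ : Fin L → A, M.blockProb γ * (1 + Real.logb 2 (1 / M.blockProb γ)) := by
    simp only [mul_add, mul_one, Finset.sum_add_distrib, blockEntropy, blockProb]
    rw [M.sum_wordProb hst.2, add_comm]
  rw [h1, h2]
  refine Finset.sum_le_sum fun γ _ => ?_
  have h0 : 0 ≤ M.blockProb γ := M.wordProb_nonneg hst.1 γ
  rcases h0.eq_or_lt with h | h
  -- The codeword length is unconstrained at a block of probability zero, which has weight zero.
  · rw [← h, zero_mul, zero_mul]
  · exact mul_le_mul_of_nonneg_left (hcode.length_le γ h) h0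

/-- With `f` the mean codeword length as a function of the state at the start of a block, the
increment `|huff γ| - c + f b - f a` of a block `γ` leading from `a` to `b` has conditional mean
`(M^L f) a - c`, because `f a` cancels the mean of `|huff γ|`. The hypotheses make this negative, so
a small exponential moment is at most one. -/
theorem exists_pos_forall_sum_exp_drift_le_one (M : HMM k A) (huff : (Fin L → A) → List Bool)
    {η c : ℝ} (hle : ∀ a b, (M.trans ^ L) a b ≤ (1 + η) * M.stationary b)
    (hc : (1 + η) * ∑ a, M.stationary a * M.meanLength huff a < c) :
    ∃ r > (0 : ℝ), ∀ a, ∑ γ : Fin L → A, ∑ b, M.wordMatrix (List.ofFn γ) a b *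
      Real.exp (r * ((huff γ).length - c + M.meanLength huff b - M.meanLength huff a)) ≤ 1 := by
  have hdrift : ∀ a, ∑ q : (Fin L → A) × Fin k, M.wordMatrix (List.ofFn q.1) a q.2 *
      ((huff q.1).length - c + M.meanLength huff q.2 - M.meanLength huff a)
      ≤ -(c - (1 + η) * ∑ a, M.stationary a * M.meanLength huff a) := fun a => by
    have h1 : ∑ γ : Fin L → A, ∑ b, M.wordMatrix (List.ofFn γ) a b * M.meanLength huff b
        = ∑ b, (M.trans ^ L) a b * M.meanLength huff b := by
      rw [Finset.sum_comm]
      simp_rw [← Finset.sum_mul, sum_wordMatrix_apply]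
    have h2 : ∑ b, (M.trans ^ L) a b * M.meanLength huff b
        ≤ (1 + η) * ∑ b, M.stationary b * M.meanLength huff b := by
      rw [Finset.mul_sum]
      refine Finset.sum_le_sum fun b _ => ?_
      rw [← mul_assoc]
      exact mul_le_mul_of_nonneg_right (hle a b) (M.meanLength_nonneg huff b)
    have h3 : ∑ γ : Fin L → A, ∑ b, M.wordMatrix (List.ofFn γ) a b *
          ((huff γ).length - c + M.meanLength huff b - M.meanLength huff a)
        = ∑ γ : Fin L → A, ∑ b, (huff γ).length * M.wordMatrix (List.ofFn γ) a b
          + ∑ γ : Fin L → A, ∑ b, M.wordMatrix (List.ofFn γ) a b * M.meanLength huff b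
          - (c + M.meanLength huff a)
            * ∑ γ : Fin L → A, ∑ b, M.wordMatrix (List.ofFn γ) a b := by
      simp only [Finset.mul_sum, ← Finset.sum_add_distrib, ← Finset.sum_sub_distrib]
      refine Finset.sum_congr rfl fun γ _ => Finset.sum_congr rfl fun b _ => by ring
    rw [Fintype.sum_prod_type]
    simp only
    rw [h3, M.sum_sum_wordMatrix, h1]
    have hf : M.meanLength huff a
        = ∑ γ : Fin L → A, ∑ b, (huff γ).length * M.wordMatrix (List.ofFn γ) a b := by
      simp only [meanLength, Finset.mul_sum]
    rw [← hf]
    linarith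
  obtain ⟨r, hr, h⟩ := exists_pos_forall_sum_mul_exp_le_one
    (fun (a : Fin k) (q : (Fin L → A) × Fin k) => M.wordMatrix (List.ofFn q.1) a q.2)
    (fun a q => (huff q.1).length - c + M.meanLength huff q.2 - M.meanLength huff a)
    (fun a q => M.wordMatrix_nonneg _ _ _)
    (fun a => by rw [Fintype.sum_prod_type]; exact M.sum_sum_wordMatrix L a)
    (sub_pos.2 hc) hdrift
  exact ⟨r, hr, fun a => by simpa only [Fintype.sum_prod_type] using h a⟩

/-- The exponential moment of the code length of `(X_0, …, X_{n-1})` grows by a factor of at most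
`exp (r * c)` per block. -/
theorem sum_exp_blocksLength_le (M : HMM k A) (huff : (Fin L → A) → List Bool) (hL : 0 < L)
    {r c : ℝ} (hr : 0 ≤ r)
    (h : ∀ a, ∑ γ : Fin L → A, ∑ b, M.wordMatrix (List.ofFn γ) a b *
      Real.exp (r * ((huff γ).length - c + M.meanLength huff b - M.meanLength huff a)) ≤ 1)
    (n : ℕ) (a : Fin k) :
    ∑ x : Fin n → A, Real.exp (r * blocksLength huff (List.ofFn x)) *
        ∑ j, M.wordMatrix (List.ofFn x) a j
      ≤ Real.exp (r * (c * (n / L : ℕ) + M.meanLength huff a)) := by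
  induction n using Nat.strong_induction_on generalizing a with
  | _ n ih =>
  rcases lt_or_ge n L with hn | hn
  · have h0 : ∀ x : Fin n → A, blocksLength huff (List.ofFn x) = 0 := fun x =>
      blocksLength_eq_zero huff (by simpa using hn)
    simp only [h0, Nat.cast_zero, mul_zero, Real.exp_zero, one_mul]
    rw [M.sum_sum_wordMatrix, Nat.div_eq_of_lt hn, Nat.cast_zero, mul_zero, zero_add]
    exact Real.one_le_exp (mul_nonneg hr (M.meanLength_nonneg huff a))
  obtain ⟨m, rfl⟩ := Nat.exists_eq_add_of_le hn
  rw [sum_ofFn_append L m fun w => Real.exp (r * blocksLength huff w) * ∑ j, M.wordMatrix w a j]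
  have hsplit : ∀ γ : Fin L → A, ∑ z : Fin m → A,
      Real.exp (r * blocksLength huff (List.ofFn γ ++ List.ofFn z)) *
        ∑ j, M.wordMatrix (List.ofFn γ ++ List.ofFn z) a j
      = ∑ b, M.wordMatrix (List.ofFn γ) a b * Real.exp (r * (huff γ).length) *
        ∑ z : Fin m → A, Real.exp (r * blocksLength huff (List.ofFn z)) *
          ∑ j, M.wordMatrix (List.ofFn z) b j := fun γ => by
    simp only [blocksLength_append huff hL, wordMatrix_append, Matrix.mul_apply, Nat.cast_add,
      mul_add, Real.exp_add]
    simp only [Finset.mul_sum]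
    rw [Finset.sum_comm' (t' := Finset.univ) (s' := fun _ => Finset.univ) (by simp)]
    conv_rhs => rw [Finset.sum_comm]
    rw [Finset.sum_comm]
    refine Finset.sum_congr rfl fun z _ => ?_
    rw [Finset.sum_comm]
    refine Finset.sum_congr rfl fun b _ => Finset.sum_congr rfl fun j _ => by ring
  calc ∑ γ : Fin L → A, ∑ z : Fin m → A,
      Real.exp (r * blocksLength huff (List.ofFn γ ++ List.ofFn z)) *
        ∑ j, M.wordMatrix (List.ofFn γ ++ List.ofFn z) a j
      ≤ ∑ γ : Fin L → A, ∑ b, M.wordMatrix (List.ofFn γ) a b * Real.exp (r * (huff γ).length) *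
        Real.exp (r * (c * (m / L : ℕ) + M.meanLength huff b)) := by
        refine Finset.sum_le_sum fun γ _ => ?_
        rw [hsplit]
        exact Finset.sum_le_sum fun b _ => mul_le_mul_of_nonneg_left (ih m (by omega) b)
          (mul_nonneg (M.wordMatrix_nonneg _ a b) (Real.exp_nonneg _))
    _ = Real.exp (r * (c * ((L + m) / L : ℕ) + M.meanLength huff a)) *
        ∑ γ : Fin L → A, ∑ b, M.wordMatrix (List.ofFn γ) a b *
          Real.exp (r * ((huff γ).length - c + M.meanLength huff b - M.meanLength huff a)) := by
        simp only [Finset.mul_sum]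
        refine Finset.sum_congr rfl fun γ _ => Finset.sum_congr rfl fun b _ => ?_
        rw [mul_assoc, ← Real.exp_add, mul_left_comm (Real.exp _), ← Real.exp_add,
          Nat.add_div_left _ hL]
        push_cast
        congr 2
        ring
    _ ≤ _ := mul_le_of_le_one_right (Real.exp_nonneg _) (h a)

/-- Markov's inequality for the exponential of the code length. -/
theorem one_sub_exp_le_prob_shortEvent (M : HMM k A) {huff : (Fin L → A) → List Bool}
    {tail : List A → List Bool} {ε r c F T : ℝ} (hr : 0 ≤ r) {n : ℕ}
    (hT : ∀ w : List A, ((iteratedHuffman huff tail w).length : ℝ) ≤ blocksLength huff w + T)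
    (hF : ∀ a, M.meanLength huff a ≤ F)
    (h : ∀ a, ∑ x : Fin n → A, Real.exp (r * blocksLength huff (List.ofFn x)) *
        ∑ j, M.wordMatrix (List.ofFn x) a j
      ≤ Real.exp (r * (c * (n / L : ℕ) + M.meanLength huff a))) :
    1 - Real.exp (r * (T + F + c * (n / L : ℕ) - M.entropyRate * (1 + ε) * n))
      ≤ M.prob (M.shortEvent ε (iteratedHuffman huff tail) n) := by
  classical
  have hmoment : ∑ x : Fin n → A, Real.exp (r * blocksLength huff (List.ofFn x)) *
      M.wordProb M.init x ≤ Real.exp (r * (c * (n / L : ℕ) + F)) := by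
    calc ∑ x : Fin n → A, Real.exp (r * blocksLength huff (List.ofFn x)) * M.wordProb M.init x
        = ∑ i, M.init i * ∑ x : Fin n → A, Real.exp (r * blocksLength huff (List.ofFn x)) *
          ∑ j, M.wordMatrix (List.ofFn x) i j := by
          simp_rw [wordProb_eq]
          simp only [Finset.mul_sum (s := (Finset.univ : Finset (Fin n → A)))]
          rw [Finset.sum_comm]
          refine Finset.sum_congr rfl fun x _ => ?_
          rw [Finset.mul_sum]
          exact Finset.sum_congr rfl fun i _ => by ring
      _ ≤ ∑ i, M.init i * Real.exp (r * (c * (n / L : ℕ) + F)) := by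
          refine Finset.sum_le_sum fun i _ => mul_le_mul_of_nonneg_left ((h i).trans ?_)
            (M.init_mem.1 i)
          have := hF i
          gcongr
      _ = Real.exp (r * (c * (n / L : ℕ) + F)) := by rw [← Finset.sum_mul, M.init_mem.2, one_mul]
  have hpoint : ∀ x : Fin n → A, M.wordProb M.init x
      ≤ (if x ∈ M.shortEvent ε (iteratedHuffman huff tail) n then M.wordProb M.init x else 0)
        + Real.exp (r * (T - M.entropyRate * (1 + ε) * n)) *
          (Real.exp (r * blocksLength huff (List.ofFn x)) * M.wordProb M.init x) := fun x => by
    have h0 := M.wordProb_nonneg M.init_mem.1 x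
    split_ifs with hx
    · exact le_add_of_nonneg_right (by positivity)
    · rw [shortEvent, Set.mem_ofPred_eq, not_le] at hx
      rw [zero_add, ← mul_assoc, ← Real.exp_add, ← mul_add]
      refine le_mul_of_one_le_left h0 (Real.one_le_exp (mul_nonneg hr ?_))
      linarith [hT (List.ofFn x)]
  have hsum := Finset.sum_le_sum fun x (_ : x ∈ Finset.univ) => hpoint x
  rw [M.sum_wordProb M.init_mem.2, Finset.sum_add_distrib, ← Finset.mul_sum] at hsum
  have h2 := mul_le_mul_of_nonneg_left hmoment
    (Real.exp_nonneg (r * (T - M.entropyRate * (1 + ε) * n)))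
  rw [← Real.exp_add, show r * (T - M.entropyRate * (1 + ε) * n) + r * (c * (n / L : ℕ) + F)
    = r * (T + F + c * (n / L : ℕ) - M.entropyRate * (1 + ε) * n) by ring] at h2
  have h3 : M.prob (M.shortEvent ε (iteratedHuffman huff tail) n) = ∑ x : Fin n → A,
      if x ∈ M.shortEvent ε (iteratedHuffman huff tail) n then M.wordProb M.init x else 0 := by
    unfold prob
    exact Finset.sum_congr rfl fun x _ => by congr
  rw [h3]
  linarith

theorem blockEntropy_nonneg (M : HMM k A) {ν : Fin k → ℝ} (hν : ν ∈ stdSimplex ℝ (Fin k))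
    (n : ℕ) : 0 ≤ M.blockEntropy ν n := by
  refine Finset.sum_nonneg fun x _ => ?_
  have h0 := M.wordProb_nonneg hν.1 x
  have h1 : M.wordProb ν x ≤ 1 := by
    rw [← M.sum_wordProb hν.2 n]
    exact Finset.single_le_sum (f := fun x : Fin n → A => M.wordProb ν x)
      (fun y _ => M.wordProb_nonneg hν.1 y) (Finset.mem_univ x)
  rw [one_div, Real.logb_inv]
  exact mul_nonneg h0 (neg_nonneg.2 (Real.logb_nonpos one_lt_two h0 h1))

end HMM

theorem mainTheorem2 {k : ℕ} {A : Type*} [Fintype A] (M : HMM k A)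
    (hirr : M.Irreducible) (haper : M.Aperiodic) (ε : ℝ) (hε : 0 < ε) :
    ∃ ε₁ > (0 : ℝ), ∃ ε₂ > (0 : ℝ), ∀ L : ℕ, M.IsCompressive ε₁ L → M.IsMixing ε₂ L →
      ∀ huff : (Fin L → A) → List Bool, M.IsBlockCode huff →
      ∀ tail : List A → List Bool,
        (∀ δ : ℝ, 0 < δ → M.IsGoodCompressor ε δ (iteratedHuffman huff tail)) ∧
        ∃ C : ℝ, ∀ δ : ℝ, 0 < δ → δ ≤ 1 → ∀ n : ℕ, C * (1 + Real.log (1 / δ)) ≤ n →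
          1 - δ ≤ M.prob (M.shortEvent ε (iteratedHuffman huff tail) n) := by
  have hpos := M.stationary_pos hirr
  obtain ⟨m, hm0, hm⟩ : ∃ m > (0 : ℝ), ∀ i, m ≤ M.stationary i := by
    rcases isEmpty_or_nonempty (Fin k) with h | h
    · exact ⟨1, one_pos, fun i => h.elim i⟩
    · obtain ⟨i, hi⟩ := Finite.exists_min M.stationary
      exact ⟨_, hpos i, hi⟩
  -- `(1 + η)² < 1 + ε / 2`: one factor is lost to compressivity and one to mixing.
  obtain ⟨η, hη, hη2⟩ : ∃ η > (0 : ℝ), (1 + η) * (1 + η) < 1 + ε / 2 := by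
    have h1 : 0 < min 1 ε := lt_min one_pos hε
    refine ⟨min 1 ε / 8, by positivity, ?_⟩
    nlinarith [min_le_left 1 ε, min_le_right 1 ε]
  refine ⟨η, hη, η * m, by positivity, fun L hcomp hmix huff hcode tail => ?_⟩
  rw [HMM.IsCompressive] at hcomp
  have hent := M.blockEntropy_nonneg M.stationary_spec.1 L
  have hL : 0 < L := by
    rcases Nat.eq_zero_or_pos L with rfl | h
    · simp only [Nat.cast_zero, mul_zero] at hcomp
      linarith
    · exact h
  have hL' : (0 : ℝ) < L := Nat.cast_pos.2 hL
  have hH : 0 < M.entropyRate := by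
    by_contra! h
    have : M.entropyRate * (1 + η) * L ≤ 0 :=
      mul_nonpos_of_nonpos_of_nonneg (mul_nonpos_of_nonpos_of_nonneg h (by positivity)) hL'.le
    linarith
  have hmean := M.sum_stationary_mul_meanLength_le hcode
  have hc : (1 + η) * ∑ a, M.stationary a * M.meanLength huff a
      < M.entropyRate * (1 + ε / 2) * L :=
    calc (1 + η) * ∑ a, M.stationary a * M.meanLength huff a
        ≤ (1 + η) * (M.entropyRate * (1 + η) * L) :=
          mul_le_mul_of_nonneg_left (hmean.trans hcomp) (by positivity)
      _ = (M.entropyRate * L) * ((1 + η) * (1 + η)) := by ring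
      _ < (M.entropyRate * L) * (1 + ε / 2) := mul_lt_mul_of_pos_left hη2 (by positivity)
      _ = _ := by ring
  obtain ⟨r, hr, hdrift⟩ := M.exists_pos_forall_sum_exp_drift_le_one huff
    (M.trans_pow_le_of_isMixing hη.le hpos hm hmix) hc
  obtain ⟨T, hT⟩ := exists_length_iteratedHuffman_le huff tail hL
  obtain ⟨F, hF0, hF⟩ : ∃ F : ℝ, 0 ≤ F ∧ ∀ a, M.meanLength huff a ≤ F :=
    ⟨∑ a, M.meanLength huff a, Finset.sum_nonneg fun a _ => M.meanLength_nonneg huff a,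
      fun a => Finset.single_le_sum (fun a _ => M.meanLength_nonneg huff a) (Finset.mem_univ a)⟩
  have hK : 0 < r * M.entropyRate * (ε / 2) := by positivity
  have main : ∀ δ : ℝ, 0 < δ → δ ≤ 1 → ∀ n : ℕ,
      (r * (T + F) + 1) / (r * M.entropyRate * (ε / 2)) * (1 + Real.log (1 / δ)) ≤ n →
      1 - δ ≤ M.prob (M.shortEvent ε (iteratedHuffman huff tail) n) := by
    intro δ hδ hδ1 n hn
    refine le_trans (sub_le_sub_left ?_ 1) (M.one_sub_exp_le_prob_shortEvent (ε := ε) hr.le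
      (T := T) (fun w => by exact_mod_cast hT w) hF
      (M.sum_exp_blocksLength_le huff hL hr.le hdrift n))
    rw [← Real.le_log_iff_exp_le hδ]
    have hl : Real.log (1 / δ) = -Real.log δ := by rw [one_div, Real.log_inv]
    have hl0 : 0 ≤ -Real.log δ := neg_nonneg.2 (Real.log_nonpos hδ.le hδ1)
    rw [hl, div_mul_eq_mul_div, div_le_iff₀ hK] at hn
    have hblocks : (L : ℝ) * (n / L : ℕ) ≤ n := by exact_mod_cast Nat.mul_div_le n L
    have hcost : M.entropyRate * (1 + ε / 2) * L * (n / L : ℕ)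
        ≤ M.entropyRate * (1 + ε / 2) * n := by
      rw [mul_assoc]
      exact mul_le_mul_of_nonneg_left hblocks (by positivity)
    have hTF : 0 ≤ r * (T + F) * -Real.log δ := by positivity
    have := mul_le_mul_of_nonneg_left hcost hr.le
    linarith
  refine ⟨fun δ hδ => ?_, _, main⟩
  obtain ⟨n₀, hn₀⟩ := exists_nat_ge
    ((r * (T + F) + 1) / (r * M.entropyRate * (ε / 2)) * (1 + Real.log (1 / min δ 1)))
  refine ⟨n₀, fun n hn => ?_⟩
  have := main (min δ 1) (lt_min hδ one_pos) (min_le_right _ _) n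
    (hn₀.trans (Nat.cast_le.2 hn))
  linarith [min_le_left δ 1]
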